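/- Fix $a\in(-1,1)$ and $\sigma_a(x)=x$ for $x\ge 0$, $\sigma_a(x)=ax$ for $x<0$. A network of depth $L\ge1$ with widths $n_0=d_{in},n_1,\dots,n_{L-1},n_L=d_{out}$ and parameters $\mathbf W=(W_1,b_1,\dots,W_L,b_L)$ represents the function $f_{\mathbf W}(x)=\tilde\alpha_L(x)$, where $\alpha_0(x)=x$, $\tilde\alpha_\ell(x)=W_\ell\alpha_{\ell-1}(x)+b_\ell$ and $\alpha_\ell(x)=\sigma_a(\tilde\alpha_\ell(x))$ entrywise; $\|\mathbf W\|^2=\sum_\ell(\|W_\ell\|_F^2+\|b_\ell\|^2)$. For $\Omega\subset\mathbb R^{d_{in}}$, let $R(f;\Omega,\sigma_a,L)\in[0,\infty]$ be the infimum of $\|\mathbf W\|^2$ over all networks of depth $L$, of any finite hidden widths, with $f_{\mathbf W}=f$ on $\Omega$ ($\infty$ if there are none). A finite piecewise linear function is a function $\mathbb R^d\to\mathbb R^e$ that is affine on each of finitely many closed polyhedra covering $\mathbb R^d$. $\mathrm{Rank}_{BN}(f;\Omega)$ is the smallest $k\in\mathbb N$ such that $f=h\circ g$ on $\Omega$ for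 finite piecewise linear functions $g:\mathbb R^{d_{in}}\to\mathbb R^k$ and $h:\mathbb R^k\to\mathbb R^{d_{out}}$. Let $\Omega\subset\mathbb R^{d_{in}}$ be bounded and let $f^*:\mathbb R^{d_{in}}\to\mathbb R^{d_{out}}$ be finite piecewise linear with $\mathrm{Rank}_{BN}(f^*;\Omega)=k$. Then there are a constant $C\ge0$, a depth $L_0$ and a width $m$, depending only on $f^*$, $\Omega$ and $a$, such that the following holds for every depth $L\geq 1$ with $L\ge L_0$ or $R(f^*;\Omega,\sigma_a,L)<\infty$. (i) $\frac1L R(f^*;\Omega,\sigma_a,L)\le k+\frac CL$. (ii) Let $N\ge1$, $x_1,\dots,x_N\in\Omega$, $\lambda>0$, let $n_1,\dots,n_{L-1}$ be hidden widths, and let $\hat{\mathbf W}$ be any global minimum, over the parameters of the depth-$L$ network with these widths, of $$\mathcal L_\lambda(\mathbf W)=\frac1N\sum_{i=1}^N\|f_{\mathbf W}(x_i)-f^*(x_i)\|^2+\frac\lambda L\|\mathbf W\|^2 .$$ If $n_\ell\ge m$ for all $1\le\ell\le L-1$, then $$\frac1L R(f_{\hat{\mathbf W}};\Omega,\sigma_a,L)\le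 k+\frac CL .$$ If $n_\ell\ge N(N+1)$ for all $1\le\ell\le L-1$, or if the infimum $R(f^*;\Omega,\sigma_a,L)$ is attained by a network whose $\ell$-th hidden width is at most $n_\ell$ for every $\ell$, then $$\frac1L R(f_{\hat{\mathbf W}};\Omega,\sigma_a,L)\le\frac1L R(f^*;\Omega,\sigma_a,L)\le k+\frac CL .$$ -/

import Mathlib

open scoped ENNReal NNReal

/-- The homogeneous nonlinearity `σ_a`: the identity on `[0, ∞)` and `x ↦ a x` on `(-∞, 0)`. -/
noncomputable def homAct (a x : ℝ) : ℝ := if 0 ≤ x then x else a * x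

/-- Squared Euclidean norm of a vector. -/
def sqNorm {d : ℕ} (v : Fin d → ℝ) : ℝ := ∑ i, v i ^ 2

/-- Squared Frobenius norm of a matrix. -/
def sqFrob {m n : ℕ} (A : Matrix (Fin m) (Fin n) ℝ) : ℝ := ∑ i, ∑ j, A i j ^ 2

/-- Parameters `(W₁, b₁, …, W_L, b_L)` of a fully connected network with input dimension `din`,
list `ns = [n₁, …, n_{L-1}]` of hidden widths and output dimension `dout`. The depth (the number
of weight matrices) is `L = ns.length + 1`. -/
inductive Network : ℕ → List ℕ → ℕ → Type
  /-- The last (affine) layer. -/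
  | output {din dout : ℕ} (A : Matrix (Fin dout) (Fin din) ℝ) (b : Fin dout → ℝ) :
      Network din [] dout
  /-- A first layer of width `n`, followed by the remaining layers. -/
  | hidden {din n dout : ℕ} {ns : List ℕ} (A : Matrix (Fin n) (Fin din) ℝ) (b : Fin n → ℝ)
      (rest : Network n ns dout) : Network din (n :: ns) dout

namespace Network

/-- The network function `f_W`: the nonlinearity is applied entrywise after each hidden layer, and
the value is the vector of pre-activations of the last layer. -/
noncomputable def eval (a : ℝ) : {din : ℕ} → {ns : List ℕ} → {dout : ℕ} →
    Network din ns dout → (Fin din → ℝ) → (Fin dout → ℝ)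
  | _, _, _, output A b, x => A.mulVec x + b
  | _, _, _, hidden A b rest, x => rest.eval a (fun i => homAct a ((A.mulVec x + b) i))

/-- The squared norm `‖W‖²` of all the parameters (weights and biases). -/
def normSq : {din : ℕ} → {ns : List ℕ} → {dout : ℕ} → Network din ns dout → ℝ
  | _, _, _, output A b => sqFrob A + sqNorm b
  | _, _, _, hidden A b rest => sqFrob A + sqNorm b + rest.normSq

/-- The regularized mean squared error of depth `L = ns.length + 1`,
`(1/N) ∑ᵢ ‖f_W(xᵢ) - f(xᵢ)‖² + (lam/L) ‖W‖²`, for outputs generated by `f`. -/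
noncomputable def loss (a lam : ℝ) {din dout N : ℕ} (x : Fin N → (Fin din → ℝ))
    (f : (Fin din → ℝ) → (Fin dout → ℝ)) {ns : List ℕ} (W : Network din ns dout) : ℝ :=
  (1 / (N : ℝ)) * ∑ i, sqNorm (W.eval a (x i) - f (x i))
    + (lam / ((ns.length + 1 : ℕ) : ℝ)) * W.normSq

/-- `W` is a global minimum of the loss among all networks with the same widths. -/
def IsGlobalMin (a lam : ℝ) {din dout N : ℕ} (x : Fin N → (Fin din → ℝ))
    (f : (Fin din → ℝ) → (Fin dout → ℝ)) {ns : List ℕ} (W : Network din ns dout) : Prop :=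
  ∀ V : Network din ns dout, W.loss a lam x f ≤ V.loss a lam x f

end Network

/-- The representation cost `R(f; Ω, σ_a, L)`: the infimum of `‖W‖²` over all networks of depth `L`,
of any finite widths, with `f_W = f` on `Ω`; it is `∞` if there is no such network. -/
noncomputable def reprCost (a : ℝ) (L : ℕ) {din dout : ℕ} (Ω : Set (Fin din → ℝ))
    (f : (Fin din → ℝ) → (Fin dout → ℝ)) : ℝ≥0∞ :=
  ⨅ (ns : List ℕ) (_ : ns.length + 1 = L) (W : Network din ns dout)
    (_ : Set.EqOn (W.eval a) f Ω), ENNReal.ofReal W.normSq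

/-- The minimum in the representation cost of `f` is attained by a network of the same depth
whose hidden widths are at most `ns`. -/
def CostAttainedWithin (a : ℝ) {din dout : ℕ} (Ω : Set (Fin din → ℝ))
    (f : (Fin din → ℝ) → (Fin dout → ℝ)) (ns : List ℕ) : Prop :=
  ∃ (ns' : List ℕ) (V : Network din ns' dout), List.Forall₂ (· ≤ ·) ns' ns ∧
    Set.EqOn (V.eval a) f Ω ∧ ENNReal.ofReal V.normSq = reprCost a (ns.length + 1) Ω f

/-- A closed convex polyhedron: a finite intersection of closed half-spaces. -/
def IsPolyhedron {d : ℕ} (P : Set (Fin d → ℝ)) : Prop :=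
  ∃ (r : ℕ) (φ : Fin r → ((Fin d → ℝ) →ₗ[ℝ] ℝ)) (c : Fin r → ℝ), P = {x | ∀ j, φ j x ≤ c j}

/-- Finite piecewise linear functions: the space is a finite union of closed polyhedra on each of
which `f` is affine (such an `f` is automatically continuous). -/
def IsFPLF {d e : ℕ} (f : (Fin d → ℝ) → (Fin e → ℝ)) : Prop :=
  ∃ (r : ℕ) (P : Fin r → Set (Fin d → ℝ)), (∀ i, IsPolyhedron (P i)) ∧
    (⋃ i, P i) = Set.univ ∧
    ∀ i, ∃ A : (Fin d → ℝ) →ᵃ[ℝ] (Fin e → ℝ), Set.EqOn f A (P i)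

/-- The bottleneck rank `Rank_BN(f; Ω)`: the smallest `k` such that `f = h ∘ g` on `Ω` for finite
piecewise linear functions `g`, `h` with inner dimension `k`. -/
noncomputable def rankBN {d e : ℕ} (Ω : Set (Fin d → ℝ)) (f : (Fin d → ℝ) → (Fin e → ℝ)) : ℕ :=
  sInf {k : ℕ | ∃ (g : (Fin d → ℝ) → (Fin k → ℝ)) (h : (Fin k → ℝ) → (Fin e → ℝ)),
    IsFPLF g ∧ IsFPLF h ∧ Set.EqOn f (h ∘ g) Ω}

/-! Factor the target as `h ∘ g` through `ℝ^k`. Both factors are network functions: a continuous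
selection of finitely many affine maps is a max-min of them (`mem_of_continuous_selection`), and for
`|a| < 1` the nonlinearity produces maxima and exact copies (`IsNetFun.adjoin_max`). On the bounded
set `g` can be shifted to be nonnegative, where identity layers of squared norm `k` act trivially.
Filling the depth with them costs `k L + C` (`exists_network_normSq_le_of_large_depth`).

A global minimum has norm at most that of any network of the same widths that fits the data
(`Network.IsGlobalMin.normSq_le`), and it represents its own function, so its norm bounds the cost
of that function. Competitors are padded to the given widths by `Network.exists_widen`. With widths
`N (N + 1)` every representing network can compete, since `Network.exists_small_width` shrinks it
without changing its values at the data points or increasing its norm. -/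

/-! ### Norms and the homogeneous nonlinearity -/

theorem sqNorm_nonneg {d : ℕ} (v : Fin d → ℝ) : 0 ≤ sqNorm v :=
  Finset.sum_nonneg fun _ _ => sq_nonneg _

theorem sqFrob_nonneg {m n : ℕ} (A : Matrix (Fin m) (Fin n) ℝ) : 0 ≤ sqFrob A :=
  Finset.sum_nonneg fun _ _ => Finset.sum_nonneg fun _ _ => sq_nonneg _

theorem sqFrob_one (k : ℕ) : sqFrob (1 : Matrix (Fin k) (Fin k) ℝ) = k := by
  simp [sqFrob, Matrix.one_apply, ite_pow]

theorem sqNorm_zero (k : ℕ) : sqNorm (0 : Fin k → ℝ) = 0 := by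
  simp [sqNorm]

theorem homAct_of_nonneg (a : ℝ) {x : ℝ} (hx : 0 ≤ x) : homAct a x = x := if_pos hx

theorem homAct_zero (a : ℝ) : homAct a 0 = 0 := homAct_of_nonneg a le_rfl

theorem homAct_mul (a : ℝ) {c : ℝ} (hc : 0 ≤ c) (x : ℝ) :
    homAct a (c * x) = c * homAct a x := by
  rcases hc.eq_or_lt with rfl | hc
  · simp [homAct]
  · unfold homAct
    by_cases hx : 0 ≤ x
    · rw [if_pos hx, if_pos (mul_nonneg hc.le hx)]
    · rw [if_neg hx, if_neg (not_le.2 (mul_neg_of_pos_of_neg hc (not_le.1 hx)))]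
      ring

theorem homAct_sub_homAct_neg (a x : ℝ) : homAct a x - homAct a (-x) = (1 + a) * x := by
  unfold homAct
  rcases lt_trichotomy x 0 with h | rfl | h
  · rw [if_neg (by linarith), if_pos (by linarith)]; ring
  · simp
  · rw [if_pos (by linarith), if_neg (by linarith)]; ring

theorem homAct_add_mul_homAct_neg (a x : ℝ) :
    homAct a x + a * homAct a (-x) = (1 - a ^ 2) * max x 0 := by
  unfold homAct
  rcases lt_trichotomy x 0 with h | rfl | h
  · rw [if_neg (by linarith), if_pos (by linarith), max_eq_right h.le]; ring
  · simp
  · rw [if_pos (by linarith), if_neg (by linarith), max_eq_left h.le]; ring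

/-! ### Operations on networks -/

namespace Network

theorem normSq_nonneg {din dout : ℕ} {ns : List ℕ} (V : Network din ns dout) : 0 ≤ V.normSq := by
  induction V with
  | output A b => exact add_nonneg (sqFrob_nonneg _) (sqNorm_nonneg _)
  | hidden A b V ih =>
    exact add_nonneg (add_nonneg (sqFrob_nonneg _) (sqNorm_nonneg _)) ih

/-- The network applying the nonlinearity to the outputs of `V` and then `W`. -/
def stack : {din mid dout : ℕ} → {ns ns' : List ℕ} → Network din ns mid →
    Network mid ns' dout → Network din (ns ++ mid :: ns') dout
  | _, _, _, _, _, output A b, W => hidden A b W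
  | _, _, _, _, _, hidden A b V, W => hidden A b (V.stack W)

theorem stack_eval (a : ℝ) {din mid dout : ℕ} {ns ns' : List ℕ} (V : Network din ns mid)
    (W : Network mid ns' dout) (x : Fin din → ℝ) :
    (V.stack W).eval a x = W.eval a (fun i => homAct a (V.eval a x i)) := by
  induction V with
  | output A b => rfl
  | hidden A b V ih => exact ih W _

theorem stack_normSq {din mid dout : ℕ} {ns ns' : List ℕ} (V : Network din ns mid)
    (W : Network mid ns' dout) : (V.stack W).normSq = V.normSq + W.normSq := by
  induction V with
  | output A b => rfl
  | hidden A b V ih =>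
    change _ + (V.stack W).normSq = _ + V.normSq + _
    rw [ih W]; ring

theorem exists_eval_affine (a : ℝ) {d n e : ℕ} {ns : List ℕ} (V : Network n ns e)
    (M : Matrix (Fin n) (Fin d) ℝ) (c : Fin n → ℝ) :
    ∃ V' : Network d ns e, ∀ x, V'.eval a x = V.eval a (M.mulVec x + c) := by
  cases V with
  | output A b =>
    refine ⟨output (A * M) (A.mulVec c + b), fun x => ?_⟩
    simp only [eval, Matrix.mulVec_add, Matrix.mulVec_mulVec, add_assoc]
  | hidden A b V =>
    refine ⟨hidden (A * M) (A.mulVec c + b) V, fun x => ?_⟩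
    simp only [eval, Matrix.mulVec_add, Matrix.mulVec_mulVec, add_assoc]

theorem exists_eval_comp (a : ℝ) {d n e : ℕ} {ns ns' : List ℕ} (U : Network d ns n)
    (V : Network n ns' e) :
    ∃ (ms : List ℕ) (W : Network d ms e), ∀ x, W.eval a x = V.eval a (U.eval a x) := by
  induction U with
  | output A b =>
    obtain ⟨W, hW⟩ := V.exists_eval_affine a A b
    exact ⟨_, W, hW⟩
  | hidden A b U ih =>
    obtain ⟨ms, W, hW⟩ := ih V
    exact ⟨_, hidden A b W, fun x => hW _⟩

/-- Only the rows of the first weight matrix meet the input, so exchanging each row separately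
suffices. `S` pairs new inputs with old ones: zero padding in `exists_widen`, equal Gram matrices in
`exists_small_width`. -/
theorem exists_eval_of_firstLayer (a : ℝ) {n n' e : ℕ} {ns : List ℕ} (V : Network n ns e)
    (S : (Fin n' → ℝ) → (Fin n → ℝ) → Prop)
    (h : ∀ w : Fin n → ℝ, ∃ w' : Fin n' → ℝ, sqNorm w' ≤ sqNorm w ∧
      ∀ z' z, S z' z → w' ⬝ᵥ z' = w ⬝ᵥ z) :
    ∃ V' : Network n' ns e, V'.normSq ≤ V.normSq ∧
      ∀ z' z, S z' z → V'.eval a z' = V.eval a z := by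
  choose T hT hS using h
  have hF : ∀ {p : ℕ} (A : Matrix (Fin p) (Fin n) ℝ),
      sqFrob (Matrix.of fun i => T (A i)) ≤ sqFrob A := fun A =>
    Finset.sum_le_sum fun i _ => hT (A i)
  have hM : ∀ {p : ℕ} (A : Matrix (Fin p) (Fin n) ℝ) (z' z), S z' z →
      (Matrix.of fun i => T (A i)).mulVec z' = A.mulVec z := fun A z' z hz =>
    funext fun i => hS (A i) z' z hz
  cases V with
  | output A b =>
    refine ⟨output (Matrix.of fun i => T (A i)) b, ?_, fun z' z hz => ?_⟩
    · exact add_le_add (hF A) le_rfl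
    · simp only [eval, hM A z' z hz]
  | hidden A b V =>
    refine ⟨hidden (Matrix.of fun i => T (A i)) b V, ?_, fun z' z hz => ?_⟩
    · exact add_le_add (add_le_add (hF A) le_rfl) le_rfl
    · simp only [eval, hM A z' z hz]

/-- Extra neurons get zero incoming and outgoing weights; they stay at `0` because the nonlinearity
fixes `0`. -/
theorem exists_widen (a : ℝ) {d e : ℕ} {ns ns' : List ℕ} (V : Network d ns e)
    (h : List.Forall₂ (· ≤ ·) ns ns') :
    ∃ V' : Network d ns' e, V'.normSq ≤ V.normSq ∧ ∀ x, V'.eval a x = V.eval a x := by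
  induction V generalizing ns' with
  | output A b =>
    cases h
    exact ⟨output A b, le_rfl, fun _ => rfl⟩
  | @hidden d n e ns A b V ih =>
    cases h with
    | @cons _ n' _ ns' hn h =>
    obtain ⟨V₁, hV₁, hV₁e⟩ := ih h
    let z0 : (Fin n → ℝ) → Fin n' → ℝ := fun z i => if h : (i : ℕ) < n then z ⟨i, h⟩ else 0
    have hsum : ∀ φ : Fin n' → ℝ, (∀ i : Fin n', ¬ (i : ℕ) < n → φ i = 0) →
        ∑ i, φ i = ∑ i : Fin n, φ (Fin.castLE hn i) := by
      intro φ hφ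
      refine (Fintype.sum_of_injective (Fin.castLE hn) (Fin.castLE_injective hn) _ _ ?_
        fun _ => rfl).symm
      intro i hi
      refine hφ i fun hlt => hi ⟨⟨i, hlt⟩, rfl⟩
    have hz0 : ∀ z i, z0 z (Fin.castLE hn i) = z i := fun z i => by simp [z0]
    have hz1 : ∀ z (i : Fin n'), ¬ (i : ℕ) < n → z0 z i = 0 := fun z i hi => by simp [z0, hi]
    have hsq : ∀ z, sqNorm (z0 z) = sqNorm z := fun z => by
      unfold sqNorm
      rw [hsum _ fun i hi => by simp [hz1 z i hi]]
      simp only [hz0]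
    obtain ⟨V₂, hV₂, hV₂e⟩ := V₁.exists_eval_of_firstLayer a (fun z' z => z' = z0 z)
      (fun w => ⟨z0 w, (hsq w).le, by
        rintro _ z rfl
        unfold dotProduct
        rw [hsum _ fun i hi => by simp [hz1 w i hi]]
        simp only [hz0]⟩)
    let A' : Matrix (Fin n') (Fin d) ℝ := Matrix.of fun i j => z0 (fun i => A i j) i
    have hA' : sqFrob A' = sqFrob A := by
      unfold sqFrob
      rw [Finset.sum_comm, Finset.sum_comm (f := fun i j => A i j ^ 2)]
      exact Finset.sum_congr rfl fun j _ => hsq fun i => A i j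
    refine ⟨hidden A' (z0 b) V₂, ?_, fun x => ?_⟩
    · change sqFrob A' + sqNorm (z0 b) + V₂.normSq ≤ sqFrob A + sqNorm b + V.normSq
      rw [hA', hsq]
      linarith
    · change V₂.eval a _ = V.eval a _
      rw [← hV₁e]
      refine hV₂e _ _ (funext fun i => ?_)
      by_cases hi : (i : ℕ) < n
      · simp [A', z0, hi, Matrix.mulVec, dotProduct]
      · simp [A', z0, hi, Matrix.mulVec, dotProduct, homAct_zero]

end Network

/-! ### Continuous selections as max-min of affine functions -/

/-- Move right from a point `t` with `G t ≥ 0`. A piece active just after `t` is by continuity also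
active at `t`. If it is nonnegative at `0` it is so on all of `[0, 1]`; if it is negative at `0`, it
is increasing and remains nonnegative after `t`. -/
theorem nonneg_one_of_continuous_selection {r : ℕ} (α β : Fin r → ℝ) (G : ℝ → ℝ)
    (hG : Continuous G) (hsel : ∀ t, ∃ j, G t = α j + β j * t) (h0 : 0 ≤ G 0)
    (h : ∀ j, 0 ≤ α j → 0 ≤ α j + β j) : 0 ≤ G 1 := by
  have key : Set.Icc (0 : ℝ) 1 ⊆ {t | 0 ≤ G t} := by
    refine IsClosed.Icc_subset_of_forall_exists_gt
      ((isClosed_le continuous_const hG).inter isClosed_Icc) h0 ?_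
    rintro t ⟨ht, ht0, ht1⟩ y hy
    have hev : ∀ᶠ z in nhds t, ∀ j, G z = α j + β j * z → G t = α j + β j * t := by
      refine Filter.eventually_all.2 fun j => ?_
      by_cases hj : G t = α j + β j * t
      · exact Filter.Eventually.of_forall fun _ _ => hj
      · have := (isOpen_ne_fun hG (by fun_prop : Continuous fun z => α j + β j * z)).mem_nhds hj
        filter_upwards [this] with z hz hz' using absurd hz' hz
    have hev' : ∀ᶠ z in nhdsWithin t (Set.Ioi t),
        (∀ j, G z = α j + β j * z → G t = α j + β j * t) ∧ z ∈ Set.Ioc t (min y 1) :=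
      (hev.filter_mono nhdsWithin_le_nhds).and (Ioc_mem_nhdsGT (lt_min hy ht1))
    obtain ⟨z, hz, hzt, hzy⟩ := hev'.exists
    refine ⟨z, ?_, hzt, hzy.trans (min_le_left _ _)⟩
    obtain ⟨j, hj⟩ := hsel z
    have htj := hz j hj
    have hz1 : z ≤ 1 := hzy.trans (min_le_right _ _)
    change 0 ≤ G t at ht
    change 0 ≤ G z
    rw [hj]
    rw [htj] at ht
    rcases le_or_gt 0 (α j) with hα | hα
    · have := h j hα
      nlinarith
    · have : 0 < β j := by
        by_contra hb
        nlinarith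
      nlinarith
  exact key ⟨zero_le_one, le_rfl⟩

theorem exists_piece_ge_le {E : Type*} [AddCommGroup E] [Module ℝ E] [TopologicalSpace E]
    [IsTopologicalAddGroup E] [ContinuousSMul ℝ E] {r : ℕ} (ℓ : Fin r → E →ᵃ[ℝ] ℝ) (f : E → ℝ)
    (hf : Continuous f) (hsel : ∀ x, ∃ j, f x = ℓ j x) (x y : E) :
    ∃ j, f y ≤ ℓ j y ∧ ℓ j x ≤ f x := by
  by_contra! hcon
  obtain ⟨ε, hε, hεj⟩ : ∃ ε : ℝ, 0 < ε ∧ ∀ j, f y ≤ ℓ j y → f x + ε ≤ ℓ j x := by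
    have : ∀ᶠ ε in nhdsWithin (0 : ℝ) (Set.Ioi 0), ∀ j, f y ≤ ℓ j y → f x + ε ≤ ℓ j x := by
      refine Filter.eventually_all.2 fun j => ?_
      by_cases hj : f y ≤ ℓ j y
      · have hpos : 0 < ℓ j x - f x := sub_pos.2 (hcon j hj)
        filter_upwards [Ioc_mem_nhdsGT hpos] with ε hε _
        linarith [hε.2]
      · exact Filter.Eventually.of_forall fun _ h => absurd h hj
    obtain ⟨ε, h, hε⟩ := (this.and self_mem_nhdsWithin).exists
    exact ⟨ε, hε, h⟩
  have hline : ∀ j t, ℓ j (AffineMap.lineMap y x t) = ℓ j y + (ℓ j x - ℓ j y) * t := by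
    intro j t
    rw [AffineMap.apply_lineMap, AffineMap.lineMap_apply]
    simp only [vsub_eq_sub, smul_eq_mul, vadd_eq_add]
    ring
  -- On the segment from `y` to `x`, subtract the affine function with end values `f y` and `f x +
  -- ε`. The result is `0` at the start and `-ε` at the end, which the lemma forbids.
  have h1 := nonneg_one_of_continuous_selection
    (fun j => ℓ j y - f y) (fun j => (ℓ j x - ℓ j y) - (f x + ε - f y))
    (fun t => f (AffineMap.lineMap y x t) - (f y + (f x + ε - f y) * t))
    ((hf.comp AffineMap.lineMap_continuous).sub (by fun_prop))
    (fun t => by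
      obtain ⟨j, hj⟩ := hsel (AffineMap.lineMap y x t)
      exact ⟨j, by rw [hj, hline]; ring⟩)
    (by simp)
    (fun j hj => by linarith [hεj j (by linarith)])
  simp only [AffineMap.lineMap_apply_one] at h1
  linarith

/-- A continuous selection of finitely many affine functions belongs to every set of functions
which contains the affine functions and is closed under maxima and minima. -/
theorem mem_of_continuous_selection {E : Type*} [AddCommGroup E] [Module ℝ E]
    [TopologicalSpace E] [IsTopologicalAddGroup E] [ContinuousSMul ℝ E] {r : ℕ}
    (ℓ : Fin r → E →ᵃ[ℝ] ℝ) (f : E → ℝ) (hf : Continuous f) (hsel : ∀ x, ∃ j, f x = ℓ j x)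
    (𝒞 : Set (E → ℝ)) (hℓ : ∀ j, ⇑(ℓ j) ∈ 𝒞) (hsup : ∀ φ ∈ 𝒞, ∀ ψ ∈ 𝒞, φ ⊔ ψ ∈ 𝒞)
    (hinf : ∀ φ ∈ 𝒞, ∀ ψ ∈ 𝒞, φ ⊓ ψ ∈ 𝒞) : f ∈ 𝒞 := by
  classical
  let S : E → Finset (Fin r) := fun y => Finset.univ.filter fun j => f y ≤ ℓ j y
  have hS : ∀ y, (S y).Nonempty := fun y => by
    obtain ⟨j, hj⟩ := hsel y
    exact ⟨j, by simp [S, hj]⟩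
  -- Each `G y` lies below `f` by `exists_piece_ge_le`, and `G x` reaches `f` at `x`, so `f` is the
  -- maximum of the `G y`.
  let G : E → E → ℝ := fun y => (S y).inf' (hS y) fun j => ⇑(ℓ j)
  have hG𝒞 : ∀ y, G y ∈ 𝒞 := fun y =>
    Finset.inf'_induction (hS y) _ (fun φ hφ ψ hψ => hinf φ hφ ψ hψ) fun j _ => hℓ j
  have hGle : ∀ y x, G y x ≤ f x := fun y x => by
    obtain ⟨j, hjy, hjx⟩ := exists_piece_ge_le ℓ f hf hsel x y
    refine le_trans ?_ hjx
    exact Finset.inf'_le (fun j => ⇑(ℓ j)) (by simpa [S] using hjy : j ∈ S y) x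
  have hGge : ∀ y x, S y = S x → f x ≤ G y x := fun y x hyx => by
    simp only [G, Finset.inf'_apply]
    refine Finset.le_inf' _ _ fun j hj => ?_
    rw [hyx] at hj
    simpa [S] using hj
  -- `G y` depends on `y` only through `S y`, so a finite maximum suffices. Sets outside the range
  -- of `S` get an arbitrary `y`, which is harmless since every `G y` is at most `f`.
  have hmain : f = (Finset.univ : Finset (Finset (Fin r))).sup' Finset.univ_nonempty
      fun s => G (Function.invFun S s) := by
    ext x
    rw [Finset.sup'_apply]
    apply le_antisymm
    · exact (hGge _ x (Function.invFun_eq ⟨x, rfl⟩)).trans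
        (Finset.le_sup' (fun s => G (Function.invFun S s) x) (Finset.mem_univ (S x)))
    · exact Finset.sup'_le _ _ fun s _ => hGle _ x
  rw [hmain]
  exact Finset.sup'_induction _ _ (fun φ hφ ψ hψ => hsup φ hφ ψ hψ) fun s _ => hG𝒞 _

/-! ### Piecewise linear functions are network functions -/

theorem IsPolyhedron.isClosed {d : ℕ} {P : Set (Fin d → ℝ)} (hP : IsPolyhedron P) :
    IsClosed P := by
  obtain ⟨r, φ, c, rfl⟩ := hP
  simp only [Set.ofPred_forall]
  exact isClosed_iInter fun j =>
    isClosed_le (φ j).continuous_of_finiteDimensional continuous_const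

theorem IsFPLF.continuous {d e : ℕ} {f : (Fin d → ℝ) → (Fin e → ℝ)} (hf : IsFPLF f) :
    Continuous f := by
  obtain ⟨r, P, hP, hcov, hA⟩ := hf
  refine (locallyFinite_of_finite P).continuous hcov (fun i => (hP i).isClosed) fun i => ?_
  obtain ⟨A, hA⟩ := hA i
  exact (A.continuous_of_finiteDimensional.continuousOn).congr hA

theorem isFPLF_id (d : ℕ) : IsFPLF (id : (Fin d → ℝ) → (Fin d → ℝ)) :=
  ⟨1, fun _ => Set.univ, fun _ => ⟨0, fun i => i.elim0, fun i => i.elim0, by simp⟩,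
    Set.iUnion_const _, fun _ => ⟨AffineMap.id ℝ _, fun _ _ => rfl⟩⟩

/-- The functions generated under composition by affine maps and entrywise application of the
nonlinearity `homAct a`. -/
inductive IsNetFun (a : ℝ) : ∀ {ι κ : Type}, ((ι → ℝ) → (κ → ℝ)) → Prop
  | affine {ι κ : Type} (A : (ι → ℝ) →ᵃ[ℝ] (κ → ℝ)) : IsNetFun a A
  | act {ι : Type} : IsNetFun a (fun (x : ι → ℝ) i => homAct a (x i))
  | comp {ι μ κ : Type} [Finite μ] {g : (μ → ℝ) → (κ → ℝ)} {f : (ι → ℝ) → (μ → ℝ)} :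
      IsNetFun a g → IsNetFun a f → IsNetFun a (g ∘ f)

namespace IsNetFun

theorem linear (a : ℝ) {ι κ : Type} (T : (ι → ℝ) →ₗ[ℝ] (κ → ℝ)) : IsNetFun a T :=
  affine T.toAffineMap

theorem reindex (a : ℝ) {ι κ : Type} (e : κ → ι) :
    IsNetFun a (fun x : ι → ℝ => x ∘ e) :=
  linear a (LinearMap.funLeft ℝ ℝ e)

theorem exists_network {a : ℝ} {ι κ : Type} {F : (ι → ℝ) → (κ → ℝ)} (hF : IsNetFun a F) :
    ∀ {d e : ℕ} (ei : ι ≃ Fin d) (eo : Fin e ≃ κ),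
      ∃ (ns : List ℕ) (V : Network d ns e), ∀ x, V.eval a x = F (x ∘ ei) ∘ eo := by
  induction hF with
  | @affine ι κ A =>
    intro d e ei eo
    let G : (Fin d → ℝ) →ᵃ[ℝ] (Fin e → ℝ) := (LinearMap.funLeft ℝ ℝ eo).toAffineMap.comp
      (A.comp (LinearMap.funLeft ℝ ℝ ei).toAffineMap)
    refine ⟨[], .output (LinearMap.toMatrix' G.linear) (G 0), fun x => ?_⟩
    change (LinearMap.toMatrix' G.linear).mulVec x + G 0 = G x
    rw [← Matrix.toLin'_apply, Matrix.toLin'_toMatrix', G.decomp]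
    simp
  | @act ι =>
    intro d e ei eo
    obtain ⟨ns, V, hV⟩ : ∃ (ns : List ℕ) (V : Network d ns e), ∀ x i,
        V.eval a x i = homAct a (x (ei (eo i))) := by
      refine ⟨[d], .hidden 1 0 (.output (Matrix.of fun i j => if ei (eo i) = j then 1 else 0) 0),
        fun x i => ?_⟩
      simp [Network.eval, Matrix.mulVec, dotProduct]
    exact ⟨ns, V, fun x => funext fun i => hV x i⟩
  | @comp ι μ κ _ g f _ _ ihg ihf =>
    intro d e ei eo
    obtain ⟨n, ⟨em⟩⟩ := Finite.exists_equiv_fin μ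
    obtain ⟨ns₁, U, hU⟩ := ihf ei em.symm
    obtain ⟨ns₂, V, hV⟩ := ihg em eo
    obtain ⟨ms, W, hW⟩ := U.exists_eval_comp a V
    refine ⟨ms, W, fun x => ?_⟩
    rw [hW, hV, hU]
    congr 2
    ext i
    simp

/-- Feeding `y` and `-y` through the nonlinearity recovers `y` (dividing by `1 + a`) and `max y 0`
(dividing by `1 - a ^ 2`). This carries all old coordinates along and gives `max p q = max (p - q) 0
+ q`. -/
theorem adjoin_max {a : ℝ} (ha : -1 < a) (ha' : a < 1) {ι κ : Type} [Finite κ]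
    {S : (ι → ℝ) → (κ → ℝ)} (hS : IsNetFun a S) (p q : κ) :
    IsNetFun a (fun x => (Option.elim' (max (S x p) (S x q)) (S x) : Option κ → ℝ)) := by
  let π : κ → (κ → ℝ) →ₗ[ℝ] ℝ := fun j => LinearMap.proj j
  let ρ : Option κ × Bool → ((Option κ × Bool) → ℝ) →ₗ[ℝ] ℝ := fun j => LinearMap.proj j
  let T₁ : (κ → ℝ) →ₗ[ℝ] ((Option κ × Bool) → ℝ) := LinearMap.pi fun i =>
    (bif i.2 then (1 : ℝ) else -1) • i.1.elim (π p - π q) π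
  let T₂ : ((Option κ × Bool) → ℝ) →ₗ[ℝ] (Option κ → ℝ) := LinearMap.pi fun i => i.elim
    ((1 / (1 - a ^ 2)) • (ρ (none, true) + a • ρ (none, false)) +
      (1 / (1 + a)) • (ρ (some q, true) - ρ (some q, false)))
    fun j => (1 / (1 + a)) • (ρ (some j, true) - ρ (some j, false))
  have h := (linear a T₂).comp ((act (a := a)).comp ((linear a T₁).comp hS))
  convert h using 1
  have h1 : 1 + a ≠ 0 := by linarith
  have h2 : 1 - a ^ 2 ≠ 0 := by nlinarith
  have hid : ∀ y : ℝ, 1 / (1 + a) * (homAct a y - homAct a (-y)) = y := fun y => by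
    rw [homAct_sub_homAct_neg]; field_simp
  have hrelu : ∀ y : ℝ, 1 / (1 - a ^ 2) * (homAct a y + a * homAct a (-y)) = max y 0 :=
    fun y => by rw [homAct_add_mul_homAct_neg]; field_simp
  funext x i
  cases i with
  | some j => simpa [T₁, T₂, π, ρ] using (hid (S x j)).symm
  | none =>
    have h3 := hid (S x q)
    have h4 := hrelu (S x p - S x q)
    have h5 : max (S x p) (S x q) = max (S x p - S x q) 0 + S x q := by
      rw [← max_add_add_right]; simp
    simp only [T₁, T₂, π, ρ, Function.comp, Option.elim_none, Option.elim_some, LinearMap.pi_apply, LinearMap.add_apply,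
      LinearMap.smul_apply, LinearMap.sub_apply, LinearMap.proj_apply, smul_eq_mul, cond_true,
      cond_false, one_mul, neg_one_mul, Option.elim'_none]
    rw [h3, h4, h5]

end IsNetFun

/-- The scalar functions that can be adjoined to any network function which keeps its input. -/
def adjoinable (a : ℝ) (ι : Type) : Set ((ι → ℝ) → ℝ) :=
  {φ | ∀ (κ : Type) [Finite κ] (S : (ι → ℝ) → (κ → ℝ)), IsNetFun a S →
    (∃ p : ι → κ, ∀ x i, S x (p i) = x i) →
    IsNetFun a (fun x => (Option.elim' (φ x) (S x) : Option κ → ℝ))}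

theorem adjoinable_affine (a : ℝ) {ι : Type} (φ : (ι → ℝ) →ᵃ[ℝ] ℝ) :
    ⇑φ ∈ adjoinable a ι := by
  rintro κ _ S hS ⟨p, hp⟩
  let A : (κ → ℝ) →ᵃ[ℝ] (Option κ → ℝ) := AffineMap.pi fun i => match i with
    | some j => (LinearMap.proj j : (κ → ℝ) →ₗ[ℝ] ℝ).toAffineMap
    | none => φ.comp (LinearMap.funLeft ℝ ℝ p).toAffineMap
  convert (IsNetFun.affine A).comp hS using 1
  funext x i
  cases i with
  | some j => rfl
  | none =>
    change φ x = φ (S x ∘ p)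
    congr 1
    exact funext fun i => (hp x i).symm

theorem adjoinable_max {a : ℝ} (ha : -1 < a) (ha' : a < 1) {ι : Type} {φ ψ : (ι → ℝ) → ℝ}
    (hφ : φ ∈ adjoinable a ι) (hψ : ψ ∈ adjoinable a ι) :
    φ ⊔ ψ ∈ adjoinable a ι := by
  rintro κ _ S hS ⟨p, hp⟩
  have h₁ := hφ κ S hS ⟨p, hp⟩
  have h₂ := hψ _ _ h₁ ⟨fun i => some (p i), hp⟩
  -- `φ` is stored at `some none` and `ψ` at `none`; the reindexing below drops both and keeps the
  -- maximum.
  have h₃ := h₂.adjoin_max ha ha' (some none) none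
  have h₄ := (IsNetFun.reindex a
    (fun i : Option κ => i.elim none fun k => some (some (some k)))).comp h₃
  convert h₄ using 1
  funext x i
  cases i <;> rfl

theorem adjoinable_neg {a : ℝ} {ι : Type} {φ : (ι → ℝ) → ℝ}
    (hφ : φ ∈ adjoinable a ι) : -φ ∈ adjoinable a ι := by
  rintro κ _ S hS ⟨p, hp⟩
  let T : (Option κ → ℝ) →ₗ[ℝ] (Option κ → ℝ) := LinearMap.pi fun i => match i with
    | some j => LinearMap.proj (some j)
    | none => -LinearMap.proj none
  convert (IsNetFun.linear a T).comp (hφ κ S hS ⟨p, hp⟩) using 1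
  funext x i
  cases i <;> rfl

theorem adjoinable_min {a : ℝ} (ha : -1 < a) (ha' : a < 1) {ι : Type} {φ ψ : (ι → ℝ) → ℝ}
    (hφ : φ ∈ adjoinable a ι) (hψ : ψ ∈ adjoinable a ι) :
    φ ⊓ ψ ∈ adjoinable a ι := by
  have h := adjoinable_neg (adjoinable_max ha ha' (adjoinable_neg hφ) (adjoinable_neg hψ))
  rwa [neg_sup, neg_neg, neg_neg] at h

/-- Adjoin the components one at a time, keeping the input available throughout, and finally project
onto them. -/
theorem isNetFun_of_adjoinable {a : ℝ} {ι κ : Type} [Finite ι] [Finite κ]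
    {f : (ι → ℝ) → (κ → ℝ)} (hf : ∀ j, (fun x => f x j) ∈ adjoinable a ι) : IsNetFun a f := by
  classical
  have key : ∀ s : Finset κ, ∃ (μ : Type) (_ : Finite μ) (S : (ι → ℝ) → (μ → ℝ)),
      IsNetFun a S ∧ (∃ p : ι → μ, ∀ x i, S x (p i) = x i) ∧
        ∀ j ∈ s, ∃ c : μ, ∀ x, S x c = f x j := by
    intro s
    induction s using Finset.induction_on with
    | empty => exact ⟨ι, ‹_›, _, IsNetFun.reindex a id, ⟨id, fun _ _ => rfl⟩, by simp⟩
    | insert j s _ ih =>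
      obtain ⟨μ, _, S, hS, ⟨p, hp⟩, hc⟩ := ih
      refine ⟨Option μ, inferInstance, _, hf j μ S hS ⟨p, hp⟩, ⟨fun i => some (p i), hp⟩, ?_⟩
      intro l hl
      rcases Finset.mem_insert.1 hl with rfl | hl
      · exact ⟨none, fun _ => rfl⟩
      · obtain ⟨c, hc⟩ := hc l hl
        exact ⟨some c, hc⟩
  have := Fintype.ofFinite κ
  obtain ⟨μ, _, S, hS, -, hc⟩ := key Finset.univ
  choose c hc using fun j => hc j (Finset.mem_univ j)
  convert (IsNetFun.reindex a c).comp hS using 1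
  funext x j
  exact (hc j x).symm

theorem IsFPLF.exists_network {a : ℝ} (ha : -1 < a) (ha' : a < 1) {d e : ℕ}
    {f : (Fin d → ℝ) → (Fin e → ℝ)} (hf : IsFPLF f) :
    ∃ (ns : List ℕ) (V : Network d ns e), ∀ x, V.eval a x = f x := by
  have hcont := hf.continuous
  obtain ⟨r, P, -, hcov, hA⟩ := hf
  choose A hA using hA
  have h : IsNetFun a f := isNetFun_of_adjoinable fun j =>
    mem_of_continuous_selection
      (fun i => (LinearMap.proj j : (Fin e → ℝ) →ₗ[ℝ] ℝ).toAffineMap.comp (A i))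
      (fun x => f x j) ((continuous_apply j).comp hcont)
      (fun x => by
        obtain ⟨i, hi⟩ := Set.mem_iUnion.1 (hcov ▸ Set.mem_univ x)
        exact ⟨i, congrFun (hA i hi) j⟩)
      _ (fun i => adjoinable_affine a _) (fun φ hφ ψ hψ => adjoinable_max ha ha' hφ hψ)
      fun φ hφ ψ hψ => adjoinable_min ha ha' hφ hψ
  exact h.exists_network (Equiv.refl _) (Equiv.refl _)

/-! ### Reducing the width on a finite data set -/

/-- Carathéodory's theorem for cones, for a sum of finitely many vectors. -/
theorem exists_conic_combination_card_le {ι E : Type*} [Fintype ι] [AddCommGroup E] [Module ℝ E]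
    [FiniteDimensional ℝ E] (v : ι → E) :
    ∃ c : ι → ℝ, (∀ i, 0 ≤ c i) ∧ ∑ i, c i • v i = ∑ i, v i ∧
      (Finset.univ.filter fun i => c i ≠ 0).card ≤ Module.finrank ℝ E := by
  classical
  suffices H : ∀ (n : ℕ) (c : ι → ℝ), (Finset.univ.filter fun i => c i ≠ 0).card = n →
      (∀ i, 0 ≤ c i) → ∑ i, c i • v i = ∑ i, v i → ∃ c : ι → ℝ, (∀ i, 0 ≤ c i) ∧
        ∑ i, c i • v i = ∑ i, v i ∧
        (Finset.univ.filter fun i => c i ≠ 0).card ≤ Module.finrank ℝ E from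
    H _ 1 rfl (fun _ => zero_le_one) (by simp)
  intro n
  induction n using Nat.strong_induction_on with
  | _ n ih =>
  intro c hcard hc hsum
  set s := Finset.univ.filter fun i => c i ≠ 0 with hs
  by_cases hn : s.card ≤ Module.finrank ℝ E
  · exact ⟨c, hc, hsum, hn⟩
  obtain ⟨g, hg, i₁, hi₁, hgi₁⟩ : ∃ g : ι → ℝ, ∑ i ∈ s, g i • v i = 0 ∧ ∃ i ∈ s, 0 < g i := by
    have hdep : ¬ LinearIndepOn ℝ v (s : Set ι) := fun hli => hn <| by
      simpa using LinearIndependent.fintype_card_le_finrank hli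
    rw [linearIndepOn_finset_iff] at hdep
    push Not at hdep
    obtain ⟨g, hg, i, hi, hgi⟩ := hdep
    rcases hgi.lt_or_gt with h | h
    · exact ⟨-g, by simp [hg], i, hi, by simpa using h⟩
    · exact ⟨g, hg, i, hi, h⟩
  -- The minimal ratio is the longest step along the relation `g` that keeps the coefficients
  -- nonnegative; it annihilates the one at `i₀`.
  obtain ⟨i₀, hi₀, hmin⟩ := (s.filter fun i => 0 < g i).exists_min_image (fun i => c i / g i)
    ⟨i₁, by simp [hi₁, hgi₁]⟩
  obtain ⟨hi₀s, hg₀⟩ := Finset.mem_filter.1 hi₀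
  let t := c i₀ / g i₀
  have ht : 0 ≤ t := div_nonneg (hc _) hg₀.le
  let c' : ι → ℝ := fun i => if i ∈ s then c i - t * g i else 0
  have hc' : ∀ i, 0 ≤ c' i := fun i => by
    by_cases hi : i ∈ s
    · simp only [c', if_pos hi]
      rcases le_or_gt (g i) 0 with h | h
      · nlinarith [hc i]
      · have := hmin i (by simp [hi, h])
        rw [le_div_iff₀ h] at this
        exact sub_nonneg.2 this
    · simp [c', hi]
  have hsum_s : ∑ i ∈ s, c i • v i = ∑ i, c i • v i :=
    Finset.sum_subset (Finset.subset_univ _) fun i _ hi => by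
      have : c i = 0 := by simpa [hs] using hi
      simp [this]
  have hsum' : ∑ i, c' i • v i = ∑ i, v i := by
    rw [← hsum, ← hsum_s, ← Finset.sum_subset (Finset.subset_univ s) fun i _ hi => by
      simp [c', hi]]
    have : ∀ i ∈ s, c' i • v i = c i • v i - t • g i • v i := fun i hi => by
      simp only [c', if_pos hi, sub_smul, mul_smul]
    rw [Finset.sum_congr rfl this, Finset.sum_sub_distrib, ← Finset.smul_sum, hg]
    simp
  refine ih _ ?_ c' rfl hc' hsum'
  rw [← hcard]
  refine Finset.card_lt_card ⟨fun i hi => ?_, fun hsub => ?_⟩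
  · by_contra h
    simp [c', h] at hi
  · have := hsub hi₀s
    simp [c', hi₀s, t, hg₀.ne'] at this

/-- Project `w` onto the span of the `z i` and use the same coefficients on the `z' i`: norms and
inner products of such combinations depend only on the Gram matrix. -/
theorem exists_inner_eq_of_gram_eq {ι E E' : Type*} [Fintype ι] [NormedAddCommGroup E]
    [InnerProductSpace ℝ E] [NormedAddCommGroup E'] [InnerProductSpace ℝ E'] (z : ι → E)
    (z' : ι → E') (h : ∀ i j, inner ℝ (z' i) (z' j) = inner ℝ (z i) (z j)) (w : E) :
    ∃ w' : E', ‖w'‖ ≤ ‖w‖ ∧ ∀ i, inner ℝ w' (z' i) = inner ℝ w (z i) := by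
  let K := Submodule.span ℝ (Set.range z)
  have : FiniteDimensional ℝ K := FiniteDimensional.span_of_finite ℝ (Set.finite_range z)
  obtain ⟨β, hβ⟩ := (Submodule.mem_span_range_iff_exists_fun ℝ).1
    (K.starProjection_apply_mem w : K.starProjection w ∈ K)
  have hin : ∀ γ : ι → ℝ, ∀ i,
      inner ℝ (∑ j, γ j • z' j) (z' i) = inner ℝ (∑ j, γ j • z j) (z i) := fun γ i => by
    simp only [sum_inner, inner_smul_left, h]
  refine ⟨∑ j, β j • z' j, ?_, fun i => ?_⟩
  · have hnorm : ‖∑ j, β j • z' j‖ ^ 2 = ‖∑ j, β j • z j‖ ^ 2 := by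
      rw [← real_inner_self_eq_norm_sq, ← real_inner_self_eq_norm_sq, inner_sum, inner_sum]
      simp only [inner_smul_right, hin]
    have := (sq_eq_sq₀ (norm_nonneg _) (norm_nonneg _)).1 hnorm
    rw [this, hβ]
    exact K.norm_starProjection_apply_le w
  · rw [hin, hβ]
    have := K.starProjection_inner_eq_zero w (z i) (Submodule.subset_span ⟨i, rfl⟩)
    rw [inner_sub_left] at this
    linarith

theorem exists_dotProduct_eq_of_gram_eq {ι : Type*} [Fintype ι] {n n' : ℕ}
    (z : ι → Fin n → ℝ) (z' : ι → Fin n' → ℝ) (h : ∀ i j, z' i ⬝ᵥ z' j = z i ⬝ᵥ z j)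
    (w : Fin n → ℝ) :
    ∃ w' : Fin n' → ℝ, sqNorm w' ≤ sqNorm w ∧ ∀ i, w' ⬝ᵥ z' i = w ⬝ᵥ z i := by
  have hin : ∀ {m : ℕ} (u v : EuclideanSpace ℝ (Fin m)),
      inner ℝ u v = u.ofLp ⬝ᵥ v.ofLp := fun u v => by
    rw [dotProduct_comm, EuclideanSpace.inner_eq_star_dotProduct]; simp
  have hsq : ∀ {m : ℕ} (u : EuclideanSpace ℝ (Fin m)), sqNorm u.ofLp = ‖u‖ ^ 2 := fun u => by
    rw [EuclideanSpace.real_norm_sq_eq]; rfl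
  obtain ⟨w', hw', hw'i⟩ := exists_inner_eq_of_gram_eq (fun i => WithLp.toLp 2 (z i))
    (fun i => WithLp.toLp 2 (z' i)) (fun i j => by simpa only [hin] using h i j)
    (WithLp.toLp 2 w)
  refine ⟨w'.ofLp, ?_, fun i => by simpa only [hin] using hw'i i⟩
  have := hsq (WithLp.toLp 2 w)
  change sqNorm w = _ at this
  rw [hsq, this]
  gcongr

/-- By homogeneity, scaling the weights and bias of neuron `j` by `√(c j)` scales its activations
alike. The layer's cost and the `N ^ 2` Gram entries of its activations are then sums over neurons
with weights `c j`, so conic Carathéodory preserves them all with at most `N ^ 2 + 1` neurons. The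
next layer needs only the Gram matrix. -/
theorem Network.exists_small_width (a : ℝ) {d e N : ℕ} (hN : 0 < N) {ns : List ℕ}
    (V : Network d ns e) (x : Fin N → Fin d → ℝ) :
    ∃ (ns' : List ℕ) (V' : Network d ns' e), ns'.length = ns.length ∧
      (∀ n ∈ ns', n ≤ N * (N + 1)) ∧ V'.normSq ≤ V.normSq ∧
      ∀ i, V'.eval a (x i) = V.eval a (x i) := by
  induction V with
  | output A b => exact ⟨[], output A b, rfl, by simp, le_rfl, fun _ => rfl⟩
  | @hidden d n e ns A b V ih =>
    obtain ⟨ns₁, V₁, hlen, hle, hV₁, hV₁e⟩ := ih fun i j => homAct a ((A.mulVec (x i) + b) j)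
    set z : Fin N → Fin n → ℝ := fun i j => homAct a ((A.mulVec (x i) + b) j) with hz
    obtain ⟨c, hc, hsum, hcard⟩ := exists_conic_combination_card_le
      (fun (j : Fin n) (o : Option (Fin N × Fin N)) =>
        o.elim ((∑ l, A j l ^ 2) + b j ^ 2) fun p => z p.1 j * z p.2 j)
    have hsum' := fun o => congrFun hsum o
    simp only [Finset.sum_apply, Pi.smul_apply, smul_eq_mul] at hsum'
    set s := Finset.univ.filter fun i => c i ≠ 0 with hs
    have hs0 : ∀ i, i ∉ s → c i = 0 := fun i hi => by simpa [hs] using hi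
    let ε : Fin s.card ≃ s := s.equivFin.symm
    have hε : ∀ φ : Fin n → ℝ, ∑ j, c (ε j) * φ (ε j) = ∑ j, c j * φ j := fun φ => by
      rw [Equiv.sum_comp ε (fun j : s => c j * φ j), Finset.sum_coe_sort s fun j => c j * φ j]
      exact Finset.sum_subset (Finset.subset_univ _) fun i _ hi => by simp [hs0 i hi]
    let A' : Matrix (Fin s.card) (Fin d) ℝ := Matrix.of fun j l => √(c (ε j)) * A (ε j) l
    let b' : Fin s.card → ℝ := fun j => √(c (ε j)) * b (ε j)
    have hz' : ∀ i j, homAct a ((A'.mulVec (x i) + b') j) = √(c (ε j)) * z i (ε j) := by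
      intro i j
      rw [hz, ← homAct_mul a (Real.sqrt_nonneg _)]
      congr 1
      simp only [Pi.add_apply, Matrix.mulVec, dotProduct, A', b', Matrix.of_apply, mul_add,
        Finset.mul_sum, mul_assoc]
    let z' : Fin N → Fin s.card → ℝ := fun i j => homAct a ((A'.mulVec (x i) + b') j)
    have hgram : ∀ i i', z' i ⬝ᵥ z' i' = z i ⬝ᵥ z i' := fun i i' => by
      have h := hsum' (some (i, i'))
      simp only [Option.elim_some] at h
      simp only [dotProduct, z', hz']
      rw [← h, ← hε]
      refine Finset.sum_congr rfl fun j _ => ?_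
      have := Real.mul_self_sqrt (hc (ε j))
      linear_combination (z i (ε j) * z i' (ε j)) * this
    have hcost : sqFrob A' + sqNorm b' = sqFrob A + sqNorm b := by
      have h := hsum' none
      simp only [Option.elim_none] at h
      simp only [sqFrob, sqNorm, A', b', Matrix.of_apply, ← Finset.sum_add_distrib]
      rw [← h, ← hε]
      refine Finset.sum_congr rfl fun j _ => ?_
      simp only [mul_pow, Real.sq_sqrt (hc _), mul_add, Finset.mul_sum]
    obtain ⟨V₂, hV₂, hV₂e⟩ := V₁.exists_eval_of_firstLayer a
      (fun y' y => ∃ i, y' = z' i ∧ y = z i) (fun w => by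
        obtain ⟨w', hw', hw'i⟩ := exists_dotProduct_eq_of_gram_eq z z' hgram w
        exact ⟨w', hw', by rintro _ _ ⟨i, rfl, rfl⟩; exact hw'i i⟩)
    refine ⟨s.card :: ns₁, hidden A' b' V₂, by simp [hlen], ?_, ?_, fun i => ?_⟩
    · intro m hm
      rcases List.mem_cons.1 hm with rfl | hm
      · have : Module.finrank ℝ (Option (Fin N × Fin N) → ℝ) = N * N + 1 := by simp
        rw [this] at hcard
        -- `N * N + 1 ≤ N * (N + 1)` because `N ≥ 1`.
        nlinarith
      · exact hle m hm
    · change sqFrob A' + sqNorm b' + V₂.normSq ≤ sqFrob A + sqNorm b + V.normSq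
      linarith
    · exact (hV₂e _ _ ⟨i, rfl, rfl⟩).trans (hV₁e i)

/-! ### Cost of representing the target -/

theorem Network.exists_prepend_identity (a : ℝ) {k e : ℕ} {ns : List ℕ} (V : Network k ns e)
    (t : ℕ) :
    ∃ V' : Network k (List.replicate t k ++ ns) e, V'.normSq = t * k + V.normSq ∧
      ∀ z, (∀ i, 0 ≤ z i) → V'.eval a z = V.eval a z := by
  induction t with
  | zero => exact ⟨V, by simp, fun _ _ => rfl⟩
  | succ t ih =>
    obtain ⟨V', hV', hV'e⟩ := ih
    refine ⟨hidden 1 0 V', ?_, fun z hz => ?_⟩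
    · change sqFrob 1 + sqNorm 0 + V'.normSq = _
      rw [sqFrob_one, sqNorm_zero, hV']
      push_cast
      ring
    · rw [← hV'e z hz]
      change V'.eval a _ = _
      congr 1
      funext i
      simpa using homAct_of_nonneg a (hz i)

theorem exists_rankBN_factorization {d e k : ℕ} {Ω : Set (Fin d → ℝ)}
    {f : (Fin d → ℝ) → (Fin e → ℝ)} (hf : IsFPLF f) (hk : rankBN Ω f = k) :
    ∃ (g : (Fin d → ℝ) → (Fin k → ℝ)) (h : (Fin k → ℝ) → (Fin e → ℝ)),
      IsFPLF g ∧ IsFPLF h ∧ Set.EqOn f (h ∘ g) Ω := by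
  rw [← Set.mem_ofPred_eq (p := fun k => ∃ (g : (Fin d → ℝ) → (Fin k → ℝ))
    (h : (Fin k → ℝ) → (Fin e → ℝ)), IsFPLF g ∧ IsFPLF h ∧ Set.EqOn f (h ∘ g) Ω), ← hk]
  exact Nat.sInf_mem ⟨d, id, f, isFPLF_id d, hf, fun _ _ => rfl⟩

theorem exists_network_normSq_le_of_large_depth {a : ℝ} (ha : -1 < a) (ha' : a < 1) {d e : ℕ}
    {Ω : Set (Fin d → ℝ)} (hΩ : Bornology.IsBounded Ω) {f : (Fin d → ℝ) → (Fin e → ℝ)}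
    (hf : IsFPLF f) :
    ∃ (C : ℝ≥0) (L₀ m : ℕ), ∀ L : ℕ, L₀ ≤ L → ∃ (ns : List ℕ) (V : Network d ns e),
      ns.length + 1 = L ∧ (∀ n ∈ ns, n ≤ m) ∧ Set.EqOn (V.eval a) f Ω ∧
        V.normSq ≤ rankBN Ω f * L + C := by
  obtain ⟨k, hk⟩ : ∃ k, rankBN Ω f = k := ⟨_, rfl⟩
  rw [hk]
  obtain ⟨g, h, hg, hh, hfgh⟩ := exists_rankBN_factorization hf hk
  obtain ⟨B, hB⟩ := hΩ.isCompact_closure.exists_bound_of_continuousOn hg.continuous.continuousOn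
  obtain ⟨ns₁, U, hU⟩ := hg.exists_network ha ha'
  -- Adding `B` makes the bottleneck nonnegative on `Ω`, so the nonlinearity does not affect it; `V`
  -- subtracts `B` again.
  obtain ⟨ns₁, U, hU'⟩ := U.exists_eval_comp a (.output (1 : Matrix (Fin k) (Fin k) ℝ) fun _ => B)
  obtain ⟨ns₂, V, hV⟩ := hh.exists_network ha ha'
  obtain ⟨V, hV'⟩ := V.exists_eval_affine a (1 : Matrix (Fin k) (Fin k) ℝ) fun _ => -B
  -- `L₀` is the sum of the depths of `U` and `V`; the remaining `t ≤ L` layers are identities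
  -- costing `k` each.
  refine ⟨⟨U.normSq + V.normSq, add_nonneg U.normSq_nonneg V.normSq_nonneg⟩,
    ns₁.length + ns₂.length + 2, ns₁.sum + k + ns₂.sum, fun L hL => ?_⟩
  obtain ⟨t, rfl⟩ := Nat.exists_eq_add_of_le hL
  obtain ⟨V₁, hV₁, hV₁e⟩ := V.exists_prepend_identity a t
  refine ⟨_, U.stack V₁, ?_, ?_, fun x hx => ?_, ?_⟩
  · simp only [List.length_append, List.length_cons, List.length_replicate]
    ring
  · intro n hn
    simp only [List.mem_append, List.mem_cons, List.mem_replicate] at hn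
    rcases hn with hn | rfl | ⟨-, rfl⟩ | hn
    · have := List.le_sum_of_mem hn
      omega
    · omega
    · omega
    · have := List.le_sum_of_mem hn
      omega
  · have hUx : U.eval a x = g x + fun _ => B := by
      rw [hU', hU]; simp [Network.eval]
    have hpos : ∀ i, 0 ≤ U.eval a x i := fun i => by
      have h1 := (norm_le_pi_norm (g x) i).trans (hB x (subset_closure hx))
      rw [Real.norm_eq_abs] at h1
      have := neg_le_of_abs_le h1
      rw [hUx]
      change 0 ≤ g x i + B
      linarith
    have hact : (fun i => homAct a (U.eval a x i)) = U.eval a x :=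
      funext fun i => homAct_of_nonneg a (hpos i)
    rw [Network.stack_eval, hact, hV₁e _ hpos, hV', hV, hUx, hfgh hx]
    change h _ = h _
    congr 1
    funext i
    simp
  · rw [Network.stack_normSq, hV₁]
    change _ ≤ _ + (U.normSq + V.normSq)
    push_cast
    have : (0 : ℝ) ≤ k * (ns₁.length + ns₂.length + 2) := by positivity
    nlinarith

theorem exists_network_of_reprCost_ne_top {a : ℝ} {L d e : ℕ} {Ω : Set (Fin d → ℝ)}
    {f : (Fin d → ℝ) → (Fin e → ℝ)} (h : reprCost a L Ω f ≠ ⊤) :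
    ∃ (ns : List ℕ) (V : Network d ns e), ns.length + 1 = L ∧ Set.EqOn (V.eval a) f Ω := by
  by_contra! hcon
  refine h ?_
  simp only [reprCost, iInf_eq_top]
  exact fun ns hns V hV => absurd hV (hcon ns V hns)

theorem reprCost_le_normSq (a : ℝ) {d e : ℕ} {Ω : Set (Fin d → ℝ)}
    {f : (Fin d → ℝ) → (Fin e → ℝ)} {ns : List ℕ} (V : Network d ns e)
    (hV : Set.EqOn (V.eval a) f Ω) :
    reprCost a (ns.length + 1) Ω f ≤ ENNReal.ofReal V.normSq :=
  iInf₂_le_of_le ns rfl (iInf₂_le V hV)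

/-- Only finitely many depths lie below `L₀`. Each one of finite cost contributes the norm and
widths of some representing network, and sums over these depths give uniform constants. -/
theorem exists_network_normSq_le {a : ℝ} (ha : -1 < a) (ha' : a < 1) {d e : ℕ}
    {Ω : Set (Fin d → ℝ)} (hΩ : Bornology.IsBounded Ω) {f : (Fin d → ℝ) → (Fin e → ℝ)}
    (hf : IsFPLF f) :
    ∃ (C : ℝ≥0) (L₀ m : ℕ), ∀ L : ℕ, (L₀ ≤ L ∨ reprCost a L Ω f ≠ ⊤) →
      ∃ (ns : List ℕ) (V : Network d ns e), ns.length + 1 = L ∧ (∀ n ∈ ns, n ≤ m) ∧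
        Set.EqOn (V.eval a) f Ω ∧ V.normSq ≤ rankBN Ω f * L + C := by
  obtain ⟨C₀, L₀, m₀, H₀⟩ := exists_network_normSq_le_of_large_depth ha ha' hΩ hf
  have H : ∀ L : ℕ, ∃ (C : ℝ≥0) (m : ℕ), reprCost a L Ω f ≠ ⊤ →
      ∃ (ns : List ℕ) (V : Network d ns e), ns.length + 1 = L ∧ (∀ n ∈ ns, n ≤ m) ∧
        Set.EqOn (V.eval a) f Ω ∧ V.normSq ≤ C := fun L => by
    by_cases hL : reprCost a L Ω f = ⊤
    · exact ⟨0, 0, fun h => absurd hL h⟩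
    · obtain ⟨ns, V, hns, hV⟩ := exists_network_of_reprCost_ne_top hL
      exact ⟨⟨V.normSq, V.normSq_nonneg⟩, ns.sum, fun _ =>
        ⟨ns, V, hns, fun n hn => List.le_sum_of_mem hn, hV, le_rfl⟩⟩
  choose C m H using H
  refine ⟨C₀ + ∑ l ∈ Finset.range L₀, C l, L₀, m₀ + ∑ l ∈ Finset.range L₀, m l, fun L hL => ?_⟩
  have hk : (0 : ℝ) ≤ rankBN Ω f * L := by positivity
  rcases le_or_gt L₀ L with hL₀ | hL₀
  · obtain ⟨ns, V, hns, hm, hV, hC⟩ := H₀ L hL₀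
    refine ⟨ns, V, hns, fun n hn => (hm n hn).trans (Nat.le_add_right _ _), hV, hC.trans ?_⟩
    have : C₀ ≤ C₀ + ∑ l ∈ Finset.range L₀, C l := le_self_add
    gcongr
  · obtain ⟨ns, V, hns, hm, hV, hC⟩ := H L (hL.resolve_left (not_le.2 hL₀))
    have hmem := Finset.mem_range.2 hL₀
    refine ⟨ns, V, hns, fun n hn => ?_, hV, ?_⟩
    · have := Finset.single_le_sum (f := m) (fun _ _ => Nat.zero_le _) hmem
      have := hm n hn
      omega
    · have : C L ≤ C₀ + ∑ l ∈ Finset.range L₀, C l :=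
        (Finset.single_le_sum (f := C) (fun _ _ => zero_le) hmem).trans le_add_self
      have : (C L : ℝ) ≤ (C₀ + ∑ l ∈ Finset.range L₀, C l : ℝ≥0) := by exact_mod_cast this
      linarith

/-! ### Global minima of the regularized loss -/

/-- The interpolating `V` pays only the regularization term, while the data term of `W` is
nonnegative. -/
theorem Network.IsGlobalMin.normSq_le {a lam : ℝ} (hlam : 0 < lam) {d e N : ℕ}
    {x : Fin N → (Fin d → ℝ)} {f : (Fin d → ℝ) → (Fin e → ℝ)} {ns : List ℕ}
    {W : Network d ns e} (hW : W.IsGlobalMin a lam x f) (V : Network d ns e)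
    (hV : ∀ i, V.eval a (x i) = f (x i)) : W.normSq ≤ V.normSq := by
  have h := hW V
  unfold Network.loss at h
  simp only [hV, sub_self, sqNorm_zero, Finset.sum_const_zero, mul_zero, zero_add] at h
  have h1 : 0 ≤ 1 / (N : ℝ) * ∑ i, sqNorm (W.eval a (x i) - f (x i)) :=
    mul_nonneg (by positivity) (Finset.sum_nonneg fun i _ => sqNorm_nonneg _)
  have h2 : 0 < lam / ((ns.length + 1 : ℕ) : ℝ) := by positivity
  exact le_of_mul_le_mul_left (by linarith) h2

theorem forall₂_le_of_forall_le {m : ℕ} : ∀ {ns' ns : List ℕ}, ns'.length = ns.length →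
    (∀ n ∈ ns', n ≤ m) → (∀ n ∈ ns, m ≤ n) → List.Forall₂ (· ≤ ·) ns' ns
  | [], [], _, _, _ => .nil
  | n' :: ns', n :: ns, hlen, h', h =>
    .cons ((h' n' (by simp)).trans (h n (by simp)))
      (forall₂_le_of_forall_le (by simpa using hlen) (fun j hj => h' j (by simp [hj]))
        fun j hj => h j (by simp [hj]))

theorem ENNReal.ofReal_div_le_add_div {r : ℝ} {k L : ℕ} {C : ℝ≥0} (hL : L ≠ 0)
    (h : r ≤ k * L + C) : ENNReal.ofReal r / (L : ℝ≥0∞) ≤ k + C / L := by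
  have h1 : ENNReal.ofReal r ≤ k * L + C := by
    refine (ENNReal.ofReal_le_ofReal h).trans (le_of_eq ?_)
    rw [ENNReal.ofReal_add (by positivity) C.coe_nonneg, ENNReal.ofReal_mul (by positivity)]
    simp
  refine (ENNReal.div_le_div_right h1 _).trans (le_of_eq ?_)
  rw [ENNReal.add_div, ENNReal.mul_div_cancel_right (by simpa using hL) (by simp)]

theorem proposition5 (a : ℝ) (ha : -1 < a) (ha' : a < 1) {din dout : ℕ}
    (Ω : Set (Fin din → ℝ)) (hΩ : Bornology.IsBounded Ω)
    (f : (Fin din → ℝ) → (Fin dout → ℝ)) (hf : IsFPLF f)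
    (k : ℕ) (hk : rankBN Ω f = k) :
    ∃ (C : ℝ≥0) (L₀ m : ℕ), ∀ L : ℕ, 1 ≤ L → (L₀ ≤ L ∨ reprCost a L Ω f ≠ ⊤) →
      reprCost a L Ω f / (L : ℝ≥0∞) ≤ (k : ℝ≥0∞) + (C : ℝ≥0∞) / (L : ℝ≥0∞) ∧
      ∀ (N : ℕ), 0 < N → ∀ x : Fin N → (Fin din → ℝ), (∀ i, x i ∈ Ω) →
      ∀ lam : ℝ, 0 < lam →
      ∀ ns : List ℕ, ns.length + 1 = L →
      ∀ W : Network din ns dout, W.IsGlobalMin a lam x f →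
        ((∀ n ∈ ns, m ≤ n) →
          reprCost a L Ω (W.eval a) / (L : ℝ≥0∞) ≤ (k : ℝ≥0∞) + (C : ℝ≥0∞) / (L : ℝ≥0∞)) ∧
        (((∀ n ∈ ns, N * (N + 1) ≤ n) ∨ CostAttainedWithin a Ω f ns) →
          reprCost a L Ω (W.eval a) / (L : ℝ≥0∞) ≤ reprCost a L Ω f / (L : ℝ≥0∞)) := by
  obtain ⟨C, L₀, m, H⟩ := exists_network_normSq_le ha ha' hΩ hf
  rw [hk] at H
  refine ⟨C, L₀, m, fun L hL hLR => ?_⟩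
  obtain ⟨ns₀, V, hns₀, hm, hV, hVC⟩ := H L hLR
  have hL0 : L ≠ 0 := Nat.one_le_iff_ne_zero.1 hL
  refine ⟨?_, fun N hN x hx lam hlam ns hns W hW => ?_⟩
  · have h := reprCost_le_normSq a V hV
    rw [hns₀] at h
    exact (ENNReal.div_le_div_right h _).trans (ENNReal.ofReal_div_le_add_div hL0 hVC)
  -- `W` represents its own function, and `U`, padded to the widths `ns`, is an admissible
  -- competitor.
  have hWle : ∀ {ns' : List ℕ} (U : Network din ns' dout), List.Forall₂ (· ≤ ·) ns' ns →
      (∀ i, U.eval a (x i) = f (x i)) →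
      reprCost a L Ω (W.eval a) ≤ ENNReal.ofReal U.normSq := by
    intro ns' U hle hU
    obtain ⟨U', hU', hU'e⟩ := U.exists_widen a hle
    have h := reprCost_le_normSq a (Ω := Ω) W fun _ _ => rfl
    rw [hns] at h
    exact h.trans (ENNReal.ofReal_le_ofReal
      ((hW.normSq_le hlam U' fun i => (hU'e _).trans (hU i)).trans hU'))
  refine ⟨fun hwide => ?_, fun h => ENNReal.div_le_div_right ?_ _⟩
  · have h := hWle V (forall₂_le_of_forall_le (by omega) hm hwide) fun i => hV (hx i)
    exact (ENNReal.div_le_div_right h _).trans (ENNReal.ofReal_div_le_add_div hL0 hVC)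
  rcases h with hwide | ⟨ns', U, hle, hU, hcost⟩
  -- The infimum need not be attained: each representing network is shrunk on the data and compared
  -- with `W` separately.
  · refine le_iInf₂ fun ns' hns' => le_iInf₂ fun U hU => ?_
    obtain ⟨ns₁, U₁, hlen, hsmall, hU₁, hU₁e⟩ := U.exists_small_width a hN x
    exact (hWle U₁ (forall₂_le_of_forall_le (by omega) hsmall hwide) fun i =>
      (hU₁e i).trans (hU (hx i))).trans (ENNReal.ofReal_le_ofReal hU₁)
  · rw [← hns, ← hcost, hns]
    exact hWle U hle fun i => hU (hx i)
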